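/- Let $\Gamma$ be a weighted digraph without loops on the vertex set $\{1,\dots,n\}$, $n>1$, with strictly positive arc weights, and let $W=(w_{ij})$ be its matrix of arc weights ($w_{ij}=0$ iff there is no arc from $i$ to $j$). Let $L=(\ell_{ij})$ be its Laplacian matrix: $\ell_{ij}=-w_{ij}$ for $j\neq i$ and $\ell_{ii}=\sum_{k\neq i}w_{ik}$. A converging tree is a weakly connected digraph in which one vertex (the root) has outdegree zero and all the other vertices have outdegree one; an in-forest of $\Gamma$ is a spanning subgraph of $\Gamma$ all of whose weak components are converging trees. The weight of a subgraph is the product of the weights of its arcs ($1$ if it has no arcs). Let $\sigma_k$ be the total weight of all in-forests of $\Gamma$ with $k$ arcs, and let $Q_k$ be the $n\times n$ matrix whose $(i,j)$ entry is the total weight of those in-forests with $k$ arcs in which $i$ belongs to a tree with root $j$. Let $d$ be the in-forest dimension of $\Gamma$, i.e., the minimum possible number of trees in an in-forest of $\Gamma$ (so the in-forests with the maximum number of arcs have exactly $n-d$ arcs). Put $J_k=\sigma_k^{-1}Q_k$ for $k=0,\dots,n-d$, and $\tilde J=J_{n-d}$. For a square matrix $A$, let $\mu_\lambda(A)$ be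 the (algebraic) multiplicity of $\lambda$ as an eigenvalue of $A$. Then: (i) $L\tilde J=\tilde JL=LQ_{n-d}=Q_{n-d}L=0$; (ii) $\tilde JJ_k=J_k\tilde J=\tilde J$ for $k=0,\dots,n-d$; (iii) $\tilde J$ is a projection: $\tilde J^2=\tilde J$; (iv) $\operatorname{rank}\tilde J=\mu_1(\tilde J)=\operatorname{tr}\tilde J=d$ and $\mu_0(\tilde J)=n-d$. -/

import Mathlib

open scoped Matrix

/-- A weighted digraph without loops on the vertex set `V`, given by its matrix of arc weights:
`w i j` is positive if there is an arc from `i` to `j` (this is then its weight), and zero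
otherwise. -/
structure WeightedDigraph (V : Type*) where
  /-- The matrix of arc weights. -/
  w : Matrix V V ℝ
  nonneg : ∀ i j, 0 ≤ w i j
  loopless : ∀ i, w i i = 0

/-- The undirected graph that corresponds to the set of arcs `A` on the vertex set `V`. -/
def underlyingGraph {V : Type*} (A : Finset (V × V)) : SimpleGraph V :=
  SimpleGraph.fromRel fun i j => (i, j) ∈ A

/-- The number of arcs in `A` that come from `v`. -/
def outdegree {V : Type*} [DecidableEq V] (A : Finset (V × V)) (v : V) : ℕ :=
  (A.filter fun a => a.1 = v).card

/-- The digraph with vertex set `S` and arc set `A` is a converging tree with root `r`: it is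
weakly connected, `r` has outdegree zero and all the other vertices have outdegree one. -/
structure IsConvergingTree {V : Type*} [DecidableEq V] (S : Set V) (A : Finset (V × V)) (r : V) :
    Prop where
  arcs_mem : ∀ a ∈ A, a.1 ∈ S ∧ a.2 ∈ S
  connected : ((underlyingGraph A).induce S).Connected
  root_mem : r ∈ S
  outdegree_root : outdegree A r = 0
  outdegree_of_ne : ∀ v ∈ S, v ≠ r → outdegree A v = 1

open Classical in
/-- The arcs in `A` that have both ends in `S`. -/
noncomputable def restrictArcs {V : Type*} (A : Finset (V × V)) (S : Set V) : Finset (V × V) :=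
  A.filter fun a => a.1 ∈ S ∧ a.2 ∈ S

/-- The weak component `c` of the digraph `(V, A)` is a converging tree with root `r`. -/
def ComponentConvergesTo {V : Type*} [DecidableEq V] (A : Finset (V × V))
    (c : (underlyingGraph A).ConnectedComponent) (r : V) : Prop :=
  IsConvergingTree c.supp (restrictArcs A c.supp) r

/-- The digraph `(V, A)` is a converging forest: all its weak components are converging trees. -/
def IsConvergingForest {V : Type*} [DecidableEq V] (A : Finset (V × V)) : Prop :=
  ∀ c : (underlyingGraph A).ConnectedComponent, ∃ r, ComponentConvergesTo A c r

/-- In the digraph `(V, A)`, the vertex `i` belongs to a tree converging to `j`. -/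
def BelongsToTreeAt {V : Type*} [DecidableEq V] (A : Finset (V × V)) (i j : V) : Prop :=
  ComponentConvergesTo A ((underlyingGraph A).connectedComponentMk i) j

/-- The number of weak components of the digraph `(V, A)`; for a converging forest, this is the
number of its converging trees. -/
noncomputable def numTrees {V : Type*} (A : Finset (V × V)) : ℕ :=
  Nat.card (underlyingGraph A).ConnectedComponent

/-- The multiplicity of `x` as the eigenvalue of a square matrix `A`, that is, as a root of its
characteristic polynomial. -/
noncomputable def eigenvalueMultiplicity {V : Type*} [Fintype V] [DecidableEq V] (x : ℝ)
    (A : Matrix V V ℝ) : ℕ :=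
  A.charpoly.rootMultiplicity x

namespace WeightedDigraph

variable {V : Type*} [Fintype V] [DecidableEq V]

/-- The Laplacian matrix: the off-diagonal entries are `-w i j` and the row sums are zero. -/
def laplacian (Γ : WeightedDigraph V) : Matrix V V ℝ :=
  Matrix.of fun i j => if i = j then ∑ k ∈ Finset.univ.erase i, Γ.w i k else -Γ.w i j

/-- `A` is the arc set of an in-forest of `Γ`, that is, of a spanning subgraph of `Γ` that is a
converging forest. A spanning subgraph is identified with its set of arcs. -/
def IsInForest (Γ : WeightedDigraph V) (A : Finset (V × V)) : Prop :=
  (∀ a ∈ A, 0 < Γ.w a.1 a.2) ∧ IsConvergingForest A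

/-- The weight of a spanning subgraph: the product of the weights of its arcs. -/
def weight (Γ : WeightedDigraph V) (A : Finset (V × V)) : ℝ :=
  ∏ a ∈ A, Γ.w a.1 a.2

open Classical in
/-- The set of all in-forests of `Γ` with `k` arcs. -/
noncomputable def inForests (Γ : WeightedDigraph V) (k : ℕ) : Finset (Finset (V × V)) :=
  Finset.univ.filter fun A => Γ.IsInForest A ∧ A.card = k

open Classical in
/-- The set of all in-forests of `Γ` with `k` arcs where `i` belongs to a tree converging to
`j`. -/
noncomputable def inForestsTo (Γ : WeightedDigraph V) (k : ℕ) (i j : V) :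
    Finset (Finset (V × V)) :=
  (Γ.inForests k).filter fun A => BelongsToTreeAt A i j

/-- The total weight `σ k` of the in-forests of `Γ` with `k` arcs. -/
noncomputable def sigma (Γ : WeightedDigraph V) (k : ℕ) : ℝ :=
  ∑ A ∈ Γ.inForests k, Γ.weight A

/-- The matrix `Q k` of in-forests of `Γ` with `k` arcs. -/
noncomputable def Q (Γ : WeightedDigraph V) (k : ℕ) : Matrix V V ℝ :=
  Matrix.of fun i j => ∑ A ∈ Γ.inForestsTo k i j, Γ.weight A

/-- The normalized matrix `J k = (σ k)⁻¹ Q k` of in-forests of `Γ` with `k` arcs. -/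
noncomputable def J (Γ : WeightedDigraph V) (k : ℕ) : Matrix V V ℝ :=
  (Γ.sigma k)⁻¹ • Γ.Q k

/-- The in-forest dimension `d` of `Γ`: the minimum possible number of converging trees in an
in-forest of `Γ`. -/
noncomputable def inForestDim (Γ : WeightedDigraph V) : ℕ :=
  sInf {m | ∃ A, Γ.IsInForest A ∧ numTrees A = m}

/-- The in-forest dimension is at most the number of vertices, so that the subtraction `n - d` of
natural numbers is the true one. -/
theorem inForestDim_le_card (Γ : WeightedDigraph V) : Γ.inForestDim ≤ Fintype.card V := by
  unfold inForestDim
  rcases Set.eq_empty_or_nonempty {m | ∃ A, Γ.IsInForest A ∧ numTrees A = m} with h | ⟨m, hm⟩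
  · simp [h]
  · refine (Nat.sInf_le hm).trans ?_
    obtain ⟨A, -, rfl⟩ := hm
    rw [← Nat.card_eq_fintype_card]
    exact Nat.card_le_card_of_surjective (underlyingGraph A).connectedComponentMk
      fun c => Quot.exists_rep c

/-- The normalized matrix `J̃ = J (n - d)` of maximum in-forests of `Γ`. -/
noncomputable def Jtilde (Γ : WeightedDigraph V) : Matrix V V ℝ :=
  Γ.J (Fintype.card V - Γ.inForestDim)

end WeightedDigraph

/-! Everything rests on the recurrence `L Q_k = σ_{k+1} I - Q_{k+1}` (`laplacian_mul_Q`). It is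
proved by a grafting bijection: a forest in which `i` is not a root is a forest in which `i` is a
root together with an arc from `i` into another tree.

Hence each `Q_k` is a polynomial in `L` and commutes with it. No in-forest has `n - d + 1` arcs, so
for `k = n - d` the right side vanishes and `L Q_{n-d} = Q_{n-d} L = 0`. If `M L = 0`, the
recurrence gives `M Q_k = σ_k M`, and symmetrically on the other side; with `M = J̃` this is (ii),
and `k = n - d` gives (iii).

For (iv), a forest with `k` arcs has `n - k` roots, so `tr Q_k = (n - k) σ_k` and `tr J̃ = d`. The
trace of an idempotent is its rank, and the rank determines its characteristic polynomial. -/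

/-! ### Forests described by directed paths to sinks; adding and deleting an arc. -/

section RootedForest

variable {V : Type*}

/-- There is a directed path from `v` to `r` along the arcs in `A`. -/
def Reaches (A : Finset (V × V)) (v r : V) : Prop :=
  Relation.ReflTransGen (fun a b => (a, b) ∈ A) v r

/-- No arc in `A` comes from `r`. -/
def IsSink (A : Finset (V × V)) (r : V) : Prop :=
  ∀ b, (r, b) ∉ A

/-- The vertex `r` is a sink that is reached from `v`. -/
def IsRootOf (A : Finset (V × V)) (v r : V) : Prop :=
  Reaches A v r ∧ IsSink A r

/-- Every vertex has at most one out-neighbour and reaches a sink. -/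
structure IsRootedForest (A : Finset (V × V)) : Prop where
  out_unique : ∀ {v a b}, (v, a) ∈ A → (v, b) ∈ A → a = b
  exists_root : ∀ v, ∃ r, IsRootOf A v r

open Classical in
/-- The sink that is reached from `v`, or `v` itself if there is none. -/
noncomputable def treeRoot (A : Finset (V × V)) (v : V) : V :=
  if h : ∃ r, IsRootOf A v r then h.choose else v

theorem underlyingGraph_adj {A : Finset (V × V)} {u v : V} :
    (underlyingGraph A).Adj u v ↔ u ≠ v ∧ ((u, v) ∈ A ∨ (v, u) ∈ A) :=
  SimpleGraph.fromRel_adj _ _ _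

theorem Reaches.mono {A B : Finset (V × V)} (h : A ⊆ B) {v r : V} (hr : Reaches A v r) :
    Reaches B v r :=
  Relation.ReflTransGen.mono (fun _ _ hab => h hab) _ _ hr

theorem IsSink.eq_of_reaches {A : Finset (V × V)} {r v : V} (hr : IsSink A r)
    (h : Reaches A r v) : v = r := by
  rcases Relation.ReflTransGen.cases_head h with h | ⟨c, hc, -⟩
  · exact h.symm
  · exact (hr _ hc).elim

theorem IsSink.mono {A B : Finset (V × V)} (h : A ⊆ B) {r : V} (hr : IsSink B r) : IsSink A r :=
  fun b hb => hr b (h hb)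

theorem IsSink.isRootOf_self {A : Finset (V × V)} {r : V} (hr : IsSink A r) : IsRootOf A r r :=
  ⟨Relation.ReflTransGen.refl, hr⟩

namespace IsRootedForest

variable {A : Finset (V × V)}

/-- Since out-neighbours are unique, of two vertices reached from `v` one reaches the other, and a
sink reaches only itself. -/
theorem isRootOf_unique (hA : IsRootedForest A) {v r s : V} (hr : IsRootOf A v r)
    (hs : IsRootOf A v s) : r = s := by
  have hu : Relator.RightUnique fun a b => (a, b) ∈ A := fun _ _ _ h h' => hA.out_unique h h'
  rcases Relation.ReflTransGen.total_of_right_unique hu hr.1 hs.1 with h | h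
  · exact (hr.2.eq_of_reaches h).symm
  · exact hs.2.eq_of_reaches h

theorem isRootOf_treeRoot (hA : IsRootedForest A) (v : V) : IsRootOf A v (treeRoot A v) := by
  have h := hA.exists_root v
  rw [treeRoot, dif_pos h]
  exact h.choose_spec

theorem treeRoot_eq_iff (hA : IsRootedForest A) {v r : V} :
    treeRoot A v = r ↔ IsRootOf A v r :=
  ⟨fun h => h ▸ hA.isRootOf_treeRoot v, fun h => hA.isRootOf_unique (hA.isRootOf_treeRoot v) h⟩

theorem treeRoot_eq_self_iff (hA : IsRootedForest A) {v : V} : treeRoot A v = v ↔ IsSink A v :=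
  hA.treeRoot_eq_iff.trans ⟨fun h => h.2, fun h => h.isRootOf_self⟩

theorem treeRoot_eq_of_mem (hA : IsRootedForest A) {u v : V} (h : (u, v) ∈ A) :
    treeRoot A u = treeRoot A v :=
  hA.treeRoot_eq_iff.2 ⟨.head h (hA.isRootOf_treeRoot v).1, (hA.isRootOf_treeRoot v).2⟩

theorem treeRoot_eq_of_reachable (hA : IsRootedForest A) {u v : V}
    (h : (underlyingGraph A).Reachable u v) : treeRoot A u = treeRoot A v := by
  obtain ⟨p⟩ := h
  induction p with
  | nil => rfl
  | cons hab _ ih =>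
    rw [← ih]
    rcases (underlyingGraph_adj.1 hab).2 with hm | hm
    · exact hA.treeRoot_eq_of_mem hm
    · exact (hA.treeRoot_eq_of_mem hm).symm

theorem empty : IsRootedForest (∅ : Finset (V × V)) where
  out_unique h := by simp at h
  exists_root v := ⟨v, IsSink.isRootOf_self fun b => by simp⟩

variable [DecidableEq V]

theorem isRootOf_insert_of_ne {i p v r : V} (hr : IsRootOf A v r) (hri : r ≠ i) :
    IsRootOf (insert (i, p) A) v r := by
  refine ⟨hr.1.mono (Finset.subset_insert _ _), fun b hb => ?_⟩
  rcases Finset.mem_insert.1 hb with h | h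
  · exact hri (Prod.ext_iff.1 h).1
  · exact hr.2 b h

/-- The new arc grafts the tree rooted at `i` onto the tree of `p`; `hp` says that these trees
differ, so no cycle is closed. -/
theorem isRootOf_insert (hA : IsRootedForest A) {i p : V} (hp : treeRoot A p ≠ i) (v : V) :
    IsRootOf (insert (i, p) A) v (if treeRoot A v = i then treeRoot A p else treeRoot A v) := by
  have hp' := isRootOf_insert_of_ne (p := p) (hA.isRootOf_treeRoot p) hp
  split_ifs with hv
  · refine ⟨Relation.ReflTransGen.trans (b := i) ?_ (.head ?_ hp'.1), hp'.2⟩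
    · exact (hA.treeRoot_eq_iff.1 hv).1.mono (Finset.subset_insert _ _)
    · exact Finset.mem_insert_self _ _
  · exact isRootOf_insert_of_ne (hA.isRootOf_treeRoot v) hv

theorem insert (hA : IsRootedForest A) {i p : V} (hi : IsSink A i) (hp : treeRoot A p ≠ i) :
    IsRootedForest (insert (i, p) A) where
  out_unique {v a b} ha hb := by
    simp only [Finset.mem_insert, Prod.mk.injEq] at ha hb
    rcases ha with ⟨rfl, rfl⟩ | ha <;> rcases hb with ⟨h, rfl⟩ | hb
    · rfl
    · exact (hi _ hb).elim
    · exact (hi _ (h ▸ ha)).elim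
    · exact hA.out_unique ha hb
  exists_root v := ⟨_, hA.isRootOf_insert hp v⟩

theorem treeRoot_insert (hA : IsRootedForest A) {i p : V} (hi : IsSink A i)
    (hp : treeRoot A p ≠ i) (v : V) :
    treeRoot (Insert.insert (i, p) A) v = if treeRoot A v = i then treeRoot A p else treeRoot A v :=
  (hA.insert hi hp).treeRoot_eq_iff.2 (hA.isRootOf_insert hp v)

theorem isSink_erase (hA : IsRootedForest A) {i p : V} (h : (i, p) ∈ A) :
    IsSink (A.erase (i, p)) i := by
  intro b hb
  rw [Finset.mem_erase] at hb
  exact hb.1 (by rw [hA.out_unique hb.2 h])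

theorem erase (hA : IsRootedForest A) {i p : V} (h : (i, p) ∈ A) :
    IsRootedForest (A.erase (i, p)) where
  out_unique ha hb := hA.out_unique (Finset.mem_of_mem_erase ha) (Finset.mem_of_mem_erase hb)
  exists_root v := by
    obtain ⟨r, hr, hs⟩ := hA.exists_root v
    induction hr using Relation.ReflTransGen.head_induction_on with
    | refl => exact ⟨r, (hs.mono (Finset.erase_subset _ _)).isRootOf_self⟩
    | @head a b hab _ ih =>
      by_cases hai : a = i
      · exact ⟨i, hai ▸ (hA.isSink_erase h).isRootOf_self⟩
      · obtain ⟨s, hs⟩ := ih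
        refine ⟨s, .head ?_ hs.1, hs.2⟩
        exact Finset.mem_erase.2 ⟨fun e => hai (Prod.ext_iff.1 e).1, hab⟩

theorem treeRoot_erase_ne (hA : IsRootedForest A) {i p : V} (h : (i, p) ∈ A) :
    treeRoot (A.erase (i, p)) p ≠ i := by
  intro hp
  have hpi : Reaches A p i :=
    ((hA.erase h).treeRoot_eq_iff.1 hp).1.mono (Finset.erase_subset _ _)
  -- The arc `(i, p)` and the path from `p` to `i` form a cycle, which a walk from `i` cannot leave
  -- because out-neighbours are unique. So `i` could reach no sink other than itself.
  have key : ∀ {u}, Reaches A i u → Reaches A u i := by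
    intro u hu
    induction hu with
    | refl => exact .refl
    | @tail u u' _ huu' ih =>
      rcases Relation.ReflTransGen.cases_head ih with e | ⟨c, hc, hci⟩
      · subst e
        exact hA.out_unique h huu' ▸ hpi
      · exact hA.out_unique hc huu' ▸ hci
  obtain ⟨r, hr, hs⟩ := hA.exists_root i
  have : i = r := hs.eq_of_reaches (key hr)
  exact hs p (this ▸ h)

end IsRootedForest

/-! ### Agreement with the definition by weak components; counting trees. -/

section Bridge

variable [DecidableEq V] {A : Finset (V × V)}

theorem underlyingGraph_reachable_of_mem {u v : V} (h : (u, v) ∈ A) :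
    (underlyingGraph A).Reachable u v := by
  by_cases huv : u = v
  · exact huv ▸ .rfl
  · exact SimpleGraph.Adj.reachable (underlyingGraph_adj.2 ⟨huv, .inl h⟩)

theorem Reaches.reachable {u v : V} (h : Reaches A u v) : (underlyingGraph A).Reachable u v := by
  induction h with
  | refl => exact .rfl
  | tail _ h ih => exact ih.trans (underlyingGraph_reachable_of_mem h)

theorem mem_restrictArcs_supp {c : (underlyingGraph A).ConnectedComponent} {a b : V}
    (ha : a ∈ c.supp) : (a, b) ∈ restrictArcs A c.supp ↔ (a, b) ∈ A := by
  simp only [restrictArcs, Finset.mem_filter, and_iff_left_iff_imp]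
  intro h
  refine ⟨ha, ?_⟩
  rw [SimpleGraph.ConnectedComponent.mem_supp_iff] at ha ⊢
  rw [← ha]
  exact (SimpleGraph.ConnectedComponent.eq.2 (underlyingGraph_reachable_of_mem h)).symm

theorem outdegree_eq_zero_iff {v : V} : outdegree A v = 0 ↔ IsSink A v := by
  simp only [outdegree, Finset.card_eq_zero, Finset.filter_eq_empty_iff, IsSink]
  exact ⟨fun h b hb => h hb rfl, fun h a ha hav => h a.2 (hav ▸ ha)⟩

theorem outdegree_restrictArcs {c : (underlyingGraph A).ConnectedComponent} {v : V}
    (hv : v ∈ c.supp) : outdegree (restrictArcs A c.supp) v = outdegree A v := by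
  unfold outdegree
  congr 1
  ext ⟨a, b⟩
  simp only [Finset.mem_filter, and_congr_left_iff]
  rintro rfl
  exact mem_restrictArcs_supp hv

theorem eq_of_outdegree_eq_one {v a b : V} (h : outdegree A v = 1) (ha : (v, a) ∈ A)
    (hb : (v, b) ∈ A) : a = b := by
  obtain ⟨x, hx⟩ := Finset.card_eq_one.1 h
  have h1 : (v, a) ∈ ({x} : Finset _) := hx ▸ Finset.mem_filter.2 ⟨ha, rfl⟩
  have h2 : (v, b) ∈ ({x} : Finset _) := hx ▸ Finset.mem_filter.2 ⟨hb, rfl⟩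
  rw [Finset.mem_singleton] at h1 h2
  exact (Prod.ext_iff.1 (h1.trans h2.symm)).2

theorem IsRootedForest.outdegree_eq_one (hA : IsRootedForest A) {v : V} (hv : ¬ IsSink A v) :
    outdegree A v = 1 := by
  simp only [IsSink, not_forall, not_not] at hv
  obtain ⟨b, hb⟩ := hv
  refine Finset.card_eq_one.2 ⟨(v, b), ?_⟩
  ext ⟨x, y⟩
  simp only [Finset.mem_filter, Finset.mem_singleton, Prod.mk.injEq]
  constructor
  · rintro ⟨h, rfl⟩
    exact ⟨rfl, hA.out_unique h hb⟩
  · rintro ⟨rfl, rfl⟩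
    exact ⟨hb, rfl⟩

theorem ComponentConvergesTo.isRootOf {c : (underlyingGraph A).ConnectedComponent} {r v : V}
    (h : ComponentConvergesTo A c r) (hv : v ∈ c.supp) : IsRootOf A v r := by
  have hrc := h.root_mem
  have hsink : IsSink A r := outdegree_eq_zero_iff.1 (outdegree_restrictArcs hrc ▸ h.outdegree_root)
  refine ⟨?_, hsink⟩
  obtain ⟨p⟩ := c.reachable_of_mem_supp hv hrc
  induction p with
  | nil => exact .refl
  | @cons a b r hab p ih =>
    have hb : b ∈ c.supp := (c.mem_supp_congr_adj hab).1 hv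
    have ih := ih h hb hrc hsink
    rcases (underlyingGraph_adj.1 hab).2 with hm | hm
    · exact .head hm ih
    -- The edge is traversed against its arc `(b, a)`. That is the only arc from `b`, so the
    -- directed path from `b` to the root already passes through `a`.
    · rcases Relation.ReflTransGen.cases_head ih with e | ⟨x, hx, hxr⟩
      · exact (hsink _ (e ▸ hm)).elim
      · have h1 : outdegree A b = 1 := by
          rw [← outdegree_restrictArcs hb]
          exact h.outdegree_of_ne b hb fun e => hsink _ (e ▸ hm)
        exact eq_of_outdegree_eq_one h1 hx hm ▸ hxr

theorem IsConvergingForest.isRootedForest (h : IsConvergingForest A) : IsRootedForest A where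
  out_unique {v a b} ha hb := by
    obtain ⟨r, hr⟩ := h ((underlyingGraph A).connectedComponentMk v)
    have hv : v ∈ ((underlyingGraph A).connectedComponentMk v).supp := rfl
    refine eq_of_outdegree_eq_one ?_ ha hb
    rw [← outdegree_restrictArcs hv]
    refine hr.outdegree_of_ne v hv ?_
    rintro rfl
    exact (hr.isRootOf hv).2 _ ha
  exists_root v := by
    obtain ⟨r, hr⟩ := h ((underlyingGraph A).connectedComponentMk v)
    exact ⟨r, hr.isRootOf rfl⟩

theorem IsRootedForest.reachable_treeRoot (hA : IsRootedForest A) (v : V) :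
    (underlyingGraph A).Reachable v (treeRoot A v) :=
  (hA.isRootOf_treeRoot v).1.reachable

theorem IsRootedForest.componentConvergesTo (hA : IsRootedForest A) (v : V) :
    ComponentConvergesTo A ((underlyingGraph A).connectedComponentMk v) (treeRoot A v) where
  arcs_mem a ha := by
    simp only [restrictArcs, Finset.mem_filter] at ha
    exact ha.2
  connected := by
    set c := (underlyingGraph A).connectedComponentMk v
    have e : (underlyingGraph (restrictArcs A c.supp)).induce c.supp
        = (underlyingGraph A).induce c.supp := by
      ext ⟨x, hx⟩ ⟨y, hy⟩
      change (underlyingGraph _).Adj x y ↔ (underlyingGraph _).Adj x y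
      rw [underlyingGraph_adj, underlyingGraph_adj]
      exact and_congr_right fun _ =>
        or_congr (mem_restrictArcs_supp hx) (mem_restrictArcs_supp hy)
    rw [e]
    exact c.connected_toSimpleGraph
  root_mem := SimpleGraph.ConnectedComponent.eq.2 (hA.reachable_treeRoot v).symm
  outdegree_root := by
    rw [outdegree_restrictArcs, outdegree_eq_zero_iff]
    · exact (hA.isRootOf_treeRoot v).2
    · exact SimpleGraph.ConnectedComponent.eq.2 (hA.reachable_treeRoot v).symm
  outdegree_of_ne u hu hne := by
    rw [outdegree_restrictArcs hu]
    refine hA.outdegree_eq_one fun hs => hne ?_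
    rw [← hA.treeRoot_eq_self_iff.2 hs]
    exact hA.treeRoot_eq_of_reachable (SimpleGraph.ConnectedComponent.eq.1 hu)

theorem isConvergingForest_iff : IsConvergingForest A ↔ IsRootedForest A := by
  refine ⟨fun h => h.isRootedForest, fun h c => ?_⟩
  induction c using SimpleGraph.ConnectedComponent.ind with
  | _ v => exact ⟨_, h.componentConvergesTo v⟩

theorem IsRootedForest.belongsToTreeAt_iff (hA : IsRootedForest A) {i j : V} :
    BelongsToTreeAt A i j ↔ treeRoot A i = j := by
  constructor
  · intro h
    exact hA.treeRoot_eq_iff.2 (ComponentConvergesTo.isRootOf h rfl)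
  · rintro rfl
    exact hA.componentConvergesTo i

theorem IsRootedForest.numTrees_eq (hA : IsRootedForest A) :
    numTrees A = Nat.card {v // IsSink A v} := by
  refine (Nat.card_congr (Equiv.ofBijective
    (fun v : {v // IsSink A v} => (underlyingGraph A).connectedComponentMk v.1) ⟨?_, ?_⟩)).symm
  · rintro ⟨u, hu⟩ ⟨v, hv⟩ h
    have := hA.treeRoot_eq_of_reachable (SimpleGraph.ConnectedComponent.eq.1 h)
    rw [hA.treeRoot_eq_self_iff.2 hu, hA.treeRoot_eq_self_iff.2 hv] at this
    exact Subtype.ext this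
  · intro c
    induction c using SimpleGraph.ConnectedComponent.ind with
    | _ v =>
      exact ⟨⟨_, (hA.isRootOf_treeRoot v).2⟩,
        SimpleGraph.ConnectedComponent.eq.2 (hA.reachable_treeRoot v).symm⟩

-- Each non-sink is the tail of exactly one arc, so `Prod.fst` matches arcs with non-sinks.
open Classical in
theorem IsRootedForest.card_sinks_add_card [Fintype V] (hA : IsRootedForest A) :
    (Finset.univ.filter fun v => IsSink A v).card + A.card = Fintype.card V := by
  have h : A.card = (Finset.univ.filter fun v => ¬ IsSink A v).card := by
    rw [← Finset.card_image_of_injOn (s := A) (f := Prod.fst)]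
    · congr 1
      ext v
      simp [IsSink]
    · rintro ⟨a, b⟩ h ⟨a', b'⟩ h' rfl
      rw [hA.out_unique h h']
  rw [h, Finset.card_filter_add_card_filter_not, Finset.card_univ]

open Classical in
theorem IsRootedForest.numTrees_eq_card [Fintype V] (hA : IsRootedForest A) :
    numTrees A = (Finset.univ.filter fun v => IsSink A v).card := by
  rw [hA.numTrees_eq, Nat.card_eq_fintype_card, Fintype.card_subtype]

theorem IsRootedForest.numTrees_add_card [Fintype V] (hA : IsRootedForest A) :
    numTrees A + A.card = Fintype.card V := by
  classical
  rw [hA.numTrees_eq_card, hA.card_sinks_add_card]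

end Bridge

end RootedForest

/-! ### Characteristic polynomial and trace of an idempotent matrix. -/

theorem Matrix.charpoly_of_isIdempotentElem {K m : Type*} [Field K] [Fintype m] [DecidableEq m]
    {A : Matrix m m K} (h : IsIdempotentElem A) :
    A.charpoly = (Polynomial.X - 1) ^ A.rank * Polynomial.X ^ (Fintype.card m - A.rank) := by
  have hf : IsIdempotentElem A.toLin' := by
    rw [IsIdempotentElem, Module.End.mul_eq_comp, ← Matrix.toLin'_mul, h.eq]
  have hr : Module.finrank K (LinearMap.range A.toLin') = A.rank := by
    rw [Matrix.rank, Matrix.toLin'_apply']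
  have hk : Module.finrank K (LinearMap.ker A.toLin') = Fintype.card m - A.rank := by
    have := LinearMap.finrank_range_add_finrank_ker A.toLin'
    rw [hr, Module.finrank_fintype_fun_eq_card] at this
    omega
  -- A projection is conjugate to the identity on its range times zero on its kernel.
  rw [← Matrix.charpoly_toLin', (LinearMap.IsIdempotentElem.isProj_range _ hf).eq_conj_prodMap, LinearEquiv.charpoly_conj,
    LinearMap.charpoly_prodMap, LinearMap.charpoly_zero, hk, ← hr]
  congr 1
  exact LinearMap.charpoly_one

theorem Matrix.trace_of_isIdempotentElem {K m : Type*} [Field K] [Fintype m] [DecidableEq m]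
    {A : Matrix m m K} (h : IsIdempotentElem A) : A.trace = A.rank := by
  have hf : IsIdempotentElem A.toLin' := by
    rw [IsIdempotentElem, Module.End.mul_eq_comp, ← Matrix.toLin'_mul, h.eq]
  have := (LinearMap.IsIdempotentElem.isProj_range _ hf).trace
  rwa [Matrix.trace_toLin'_eq, Matrix.toLin'_apply', ← Matrix.rank] at this

theorem eigenvalueMultiplicity_one_of_isIdempotentElem {m : Type*} [Fintype m] [DecidableEq m]
    {A : Matrix m m ℝ} (h : IsIdempotentElem A) : eigenvalueMultiplicity 1 A = A.rank := by
  rw [eigenvalueMultiplicity, Matrix.charpoly_of_isIdempotentElem h, ← Polynomial.C_1, mul_comm,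
    Polynomial.rootMultiplicity_mul_X_sub_C_pow (by simp [Polynomial.X_ne_zero]),
    Polynomial.rootMultiplicity_eq_zero (by simp), zero_add]

theorem eigenvalueMultiplicity_zero_of_isIdempotentElem {m : Type*} [Fintype m] [DecidableEq m]
    {A : Matrix m m ℝ} (h : IsIdempotentElem A) :
    eigenvalueMultiplicity 0 A = Fintype.card m - A.rank := by
  have h1 : (Polynomial.X - 1 : Polynomial ℝ) ≠ 0 := Polynomial.X_sub_C_ne_zero 1
  have h2 := Polynomial.rootMultiplicity_mul_X_sub_C_pow (a := (0 : ℝ))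
    (n := Fintype.card m - A.rank) (pow_ne_zero A.rank h1)
  rw [Polynomial.C_0, sub_zero] at h2
  rw [eigenvalueMultiplicity, Matrix.charpoly_of_isIdempotentElem h, h2,
    Polynomial.rootMultiplicity_eq_zero (by simp), zero_add]

/-! ### Weighted forest sums and the recurrence for `L Q_k`. -/

theorem sum_sum_antisymm_eq_zero {V : Type*} {s : Finset V} {f : V → V → ℝ} (h : ∀ a b, f a b = -f b a) :
    ∑ a ∈ s, ∑ b ∈ s, f a b = 0 := by
  have h1 : ∑ a ∈ s, ∑ b ∈ s, f a b = -∑ a ∈ s, ∑ b ∈ s, f a b := by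
    conv_lhs => rw [Finset.sum_comm]
    rw [← Finset.sum_neg_distrib]
    refine Finset.sum_congr rfl fun a _ => ?_
    rw [← Finset.sum_neg_distrib]
    exact Finset.sum_congr rfl fun b _ => h b a
  linarith

namespace WeightedDigraph

variable {V : Type*} [DecidableEq V] (Γ : WeightedDigraph V)

theorem weight_insert {G : Finset (V × V)} {i : V} (hi : IsSink G i) (p : V) :
    Γ.weight (insert (i, p) G) = Γ.w i p * Γ.weight G :=
  Finset.prod_insert (hi p)

theorem isInForest_iff {A : Finset (V × V)} :
    Γ.IsInForest A ↔ (∀ a ∈ A, 0 < Γ.w a.1 a.2) ∧ IsRootedForest A := by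
  rw [IsInForest, isConvergingForest_iff]

theorem inForestDim_le {A : Finset (V × V)} (hA : Γ.IsInForest A) : Γ.inForestDim ≤ numTrees A :=
  Nat.sInf_le ⟨A, hA, rfl⟩

end WeightedDigraph

section ForestSums

variable {V : Type*} [Fintype V] [DecidableEq V]

open Classical in
/-- The arc sets of the rooted forests with `k` arcs. -/
noncomputable def rootedForests (V : Type*) [Fintype V] [DecidableEq V] (k : ℕ) :
    Finset (Finset (V × V)) :=
  Finset.univ.filter fun A => IsRootedForest A ∧ A.card = k

theorem mem_rootedForests {k : ℕ} {A : Finset (V × V)} :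
    A ∈ rootedForests V k ↔ IsRootedForest A ∧ A.card = k := by
  simp [rootedForests]

open Classical in
/-- A forest where `i` is not a sink arises in a unique way from a forest where `i` is a sink and an
arc from `i` to another tree. -/
theorem sum_rootedForests_succ_not_isSink {M : Type*} [AddCommMonoid M] (i : V) (k : ℕ)
    (f : Finset (V × V) → M) :
    ∑ F ∈ rootedForests V (k + 1) with ¬ IsSink F i, f F =
      ∑ G ∈ rootedForests V k with IsSink G i, ∑ p with treeRoot G p ≠ i, f (insert (i, p) G) := by
  rw [Finset.sum_sigma']
  symm
  refine Finset.sum_bij (fun x _ => insert (i, x.2) x.1) ?_ ?_ ?_ fun _ _ => rfl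
  · rintro ⟨G, p⟩ h
    simp only [Finset.mem_sigma, Finset.mem_filter, mem_rootedForests, Finset.mem_univ,
      true_and] at h ⊢
    obtain ⟨⟨⟨hG, rfl⟩, hi⟩, hp⟩ := h
    refine ⟨⟨hG.insert hi hp, Finset.card_insert_of_notMem (hi p)⟩, fun h => ?_⟩
    exact h p (Finset.mem_insert_self _ _)
  · rintro ⟨G, p⟩ h ⟨G', p'⟩ h' e
    simp only [Finset.mem_sigma, Finset.mem_filter, mem_rootedForests, Finset.mem_univ,
      true_and] at h h' e
    have hp : p = p' := by
      have : (i, p) ∈ insert (i, p') G' := e ▸ Finset.mem_insert_self _ _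
      rcases Finset.mem_insert.1 this with h0 | h0
      · exact (Prod.ext_iff.1 h0).2
      · exact (h'.1.2 _ h0).elim
    subst hp
    have hG : G = G' := by
      rw [← Finset.erase_insert (h.1.2 p), e, Finset.erase_insert (h'.1.2 p)]
    rw [hG]
  · intro F hF
    simp only [Finset.mem_filter, mem_rootedForests] at hF
    obtain ⟨⟨hF, hc⟩, hi⟩ := hF
    simp only [IsSink, not_forall, not_not] at hi
    obtain ⟨p, hp⟩ := hi
    refine ⟨⟨F.erase (i, p), p⟩, ?_, Finset.insert_erase hp⟩
    simp only [Finset.mem_sigma, Finset.mem_filter, mem_rootedForests, Finset.mem_univ, true_and]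
    exact ⟨⟨⟨hF.erase hp, by rw [Finset.card_erase_of_mem hp, hc]; rfl⟩, hF.isSink_erase hp⟩,
      hF.treeRoot_erase_ne hp⟩

namespace WeightedDigraph

variable (Γ : WeightedDigraph V)

open Classical in
theorem mem_inForests {k : ℕ} {A : Finset (V × V)} :
    A ∈ Γ.inForests k ↔ (∀ a ∈ A, 0 < Γ.w a.1 a.2) ∧ A ∈ rootedForests V k := by
  rw [inForests, Finset.mem_filter, isInForest_iff, mem_rootedForests, and_assoc]
  exact and_iff_right (Finset.mem_univ _)

theorem inForests_subset (k : ℕ) : Γ.inForests k ⊆ rootedForests V k :=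
  fun _ h => (Γ.mem_inForests.1 h).2

/-- This lets the sums run over all rooted forests on `V`, so that the grafting bijection need not
track which pairs are arcs of `Γ`. -/
theorem weight_eq_zero {k : ℕ} {A : Finset (V × V)} (hA : A ∈ rootedForests V k)
    (h : A ∉ Γ.inForests k) : Γ.weight A = 0 := by
  rw [mem_inForests, not_and_or] at h
  rcases h with h | h
  · simp only [not_forall, not_lt] at h
    obtain ⟨a, ha, haw⟩ := h
    exact Finset.prod_eq_zero ha (le_antisymm haw (Γ.nonneg _ _))
  · exact (h hA).elim

theorem weight_pos {k : ℕ} {A : Finset (V × V)} (hA : A ∈ Γ.inForests k) : 0 < Γ.weight A :=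
  Finset.prod_pos (Γ.mem_inForests.1 hA).1

theorem sigma_eq_sum (k : ℕ) : Γ.sigma k = ∑ F ∈ rootedForests V k, Γ.weight F :=
  Finset.sum_subset (Γ.inForests_subset k) fun _ h h' => Γ.weight_eq_zero h h'

theorem Q_apply (k : ℕ) (i j : V) :
    Γ.Q k i j = ∑ F ∈ rootedForests V k, Γ.weight F * if treeRoot F i = j then 1 else 0 := by
  classical
  rw [Q, Matrix.of_apply, inForestsTo, Finset.sum_filter,
    ← Finset.sum_subset (Γ.inForests_subset k)]
  · refine Finset.sum_congr rfl fun F hF => ?_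
    have hF := (mem_rootedForests.1 (Γ.inForests_subset k hF)).1
    rw [mul_ite, mul_one, mul_zero]
    exact if_congr hF.belongsToTreeAt_iff rfl rfl
  · intro F h h'
    rw [Γ.weight_eq_zero h h', zero_mul]

theorem laplacian_mul_apply (M : Matrix V V ℝ) (i j : V) :
    (Γ.laplacian * M) i j = ∑ m, Γ.w i m * (M i j - M m j) := by
  have h (m : V) : Γ.laplacian i m = (if m = i then ∑ k, Γ.w i k else 0) - Γ.w i m := by
    rw [laplacian, Matrix.of_apply]
    by_cases him : i = m
    · subst him
      rw [if_pos rfl, if_pos rfl, Γ.loopless, sub_zero,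
        ← Finset.add_sum_erase _ _ (Finset.mem_univ i), Γ.loopless, zero_add]
    · rw [if_neg him, if_neg (Ne.symm him), zero_sub]
  simp only [Matrix.mul_apply, h, sub_mul, ite_mul, zero_mul, Finset.sum_sub_distrib,
    Finset.sum_ite_eq', Finset.mem_univ, if_true, mul_sub, Finset.sum_mul]

-- Entrywise, both sides are sums over forests, split by whether `i` is a sink. Non-sink terms on
-- the left cancel, sink terms on the right vanish, and the bijection matches the rest.
open Classical in
theorem laplacian_mul_Q (k : ℕ) :
    Γ.laplacian * Γ.Q k = Γ.sigma (k + 1) • (1 : Matrix V V ℝ) - Γ.Q (k + 1) := by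
  ext i j
  let δ : V → ℝ := fun v => if v = j then 1 else 0
  have hL : (Γ.laplacian * Γ.Q k) i j = ∑ F ∈ rootedForests V k,
      Γ.weight F * ∑ m, Γ.w i m * (δ (treeRoot F i) - δ (treeRoot F m)) := by
    rw [laplacian_mul_apply]
    simp only [Q_apply, ← Finset.sum_sub_distrib, Finset.mul_sum]
    rw [Finset.sum_comm]
    refine Finset.sum_congr rfl fun F _ => Finset.sum_congr rfl fun m _ => ?_
    simp only [δ]
    ring
  have hR : (Γ.sigma (k + 1) • (1 : Matrix V V ℝ) - Γ.Q (k + 1)) i j =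
      ∑ F ∈ rootedForests V (k + 1), Γ.weight F * (δ i - δ (treeRoot F i)) := by
    rw [Matrix.sub_apply, Matrix.smul_apply, Matrix.one_apply, Q_apply, sigma_eq_sum, smul_eq_mul,
      Finset.sum_mul, ← Finset.sum_sub_distrib]
    exact Finset.sum_congr rfl fun F _ => (mul_sub _ _ _).symm
  have hL0 : ∑ F ∈ rootedForests V k with ¬ IsSink F i,
      Γ.weight F * ∑ m, Γ.w i m * (δ (treeRoot F i) - δ (treeRoot F m)) = 0 := by
    cases k with
    | zero =>
      refine Finset.sum_eq_zero fun F hF => ?_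
      simp only [Finset.mem_filter, mem_rootedForests, Finset.card_eq_zero] at hF
      obtain ⟨⟨-, rfl⟩, h⟩ := hF
      exact (h fun b => by simp).elim
    | succ k =>
      rw [sum_rootedForests_succ_not_isSink]
      refine Finset.sum_eq_zero fun G hG => ?_
      simp only [Finset.mem_filter, mem_rootedForests] at hG
      obtain ⟨⟨hG, -⟩, hi⟩ := hG
      have hroot : treeRoot G i = i := hG.treeRoot_eq_self_iff.2 hi
      -- With `F = G + (i, p)`, the root of `i` in `F` is the root of `p` in `G`. Vertices `m` of
      -- the tree of `i` in `G` share it and contribute zero; for the others, exchanging `p` and `m`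
      -- changes the sign.
      rw [← mul_zero (Γ.weight G), ← sum_sum_antisymm_eq_zero (s := {p | treeRoot G p ≠ i})
        (f := fun p m => Γ.w i p * Γ.w i m * (δ (treeRoot G p) - δ (treeRoot G m)))
        fun a b => by ring, Finset.mul_sum]
      refine Finset.sum_congr rfl fun p hp => ?_
      have hp := (Finset.mem_filter.1 hp).2
      rw [Γ.weight_insert hi, Finset.sum_filter, mul_comm (Γ.w i p), mul_assoc, Finset.mul_sum]
      congr 1
      refine Finset.sum_congr rfl fun m _ => ?_
      rw [hG.treeRoot_insert hi hp, hG.treeRoot_insert hi hp, if_pos hroot]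
      by_cases hm : treeRoot G m = i
      · rw [if_pos hm, if_neg (not_not.2 hm), sub_self, mul_zero, mul_zero]
      · rw [if_neg hm, if_pos hm]
        ring
  have hR0 : ∑ F ∈ rootedForests V (k + 1) with IsSink F i,
      Γ.weight F * (δ i - δ (treeRoot F i)) = 0 := by
    refine Finset.sum_eq_zero fun F hF => ?_
    simp only [Finset.mem_filter, mem_rootedForests] at hF
    rw [hF.1.1.treeRoot_eq_self_iff.2 hF.2, sub_self, mul_zero]
  rw [hL, hR, ← Finset.sum_filter_add_sum_filter_not _ (fun F => IsSink F i), hL0, add_zero,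
    ← Finset.sum_filter_add_sum_filter_not (rootedForests V (k + 1)) (fun F => IsSink F i), hR0,
    zero_add, sum_rootedForests_succ_not_isSink]
  -- The factor `Γ.w i m` from the Laplacian is the weight of the grafted arc `(i, m)`; if `m` lies
  -- in the tree of `i`, the difference of indicators is zero.
  refine Finset.sum_congr rfl fun G hG => ?_
  simp only [Finset.mem_filter, mem_rootedForests] at hG
  obtain ⟨⟨hG, -⟩, hi⟩ := hG
  have hroot : treeRoot G i = i := hG.treeRoot_eq_self_iff.2 hi
  rw [Finset.sum_filter, Finset.mul_sum]
  refine Finset.sum_congr rfl fun m _ => ?_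
  by_cases hm : treeRoot G m = i
  · rw [if_neg (not_not.2 hm), hm, hroot, sub_self, mul_zero, mul_zero]
  · rw [if_pos hm, Γ.weight_insert hi, hG.treeRoot_insert hi hm, if_pos hroot, hroot]
    ring

/-! ### Algebraic consequences of the recurrence. -/

theorem rootedForests_zero : rootedForests V 0 = {∅} := by
  ext A
  rw [mem_rootedForests, Finset.card_eq_zero, Finset.mem_singleton]
  exact ⟨fun h => h.2, fun h => ⟨h ▸ IsRootedForest.empty, h⟩⟩

theorem Q_zero : Γ.Q 0 = 1 := by
  ext i j
  have : treeRoot (∅ : Finset (V × V)) i = i :=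
    IsRootedForest.empty.treeRoot_eq_self_iff.2 fun b => by simp
  simp [Q_apply, rootedForests_zero, weight, this, Matrix.one_apply]

theorem sigma_zero : Γ.sigma 0 = 1 := by
  simp [sigma_eq_sum, rootedForests_zero, weight]

theorem Q_succ (k : ℕ) :
    Γ.Q (k + 1) = Γ.sigma (k + 1) • (1 : Matrix V V ℝ) - Γ.laplacian * Γ.Q k := by
  rw [laplacian_mul_Q, sub_sub_cancel]

theorem commute_laplacian_Q (k : ℕ) : Commute Γ.laplacian (Γ.Q k) := by
  induction k with
  | zero => rw [Q_zero]; exact Commute.one_right _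
  | succ k ih =>
    rw [Q_succ]
    exact ((Commute.one_right _).smul_right _).sub_right ((Commute.refl _).mul_right ih)

theorem mul_Q_of_mul_laplacian_eq_zero {M : Matrix V V ℝ} (h : M * Γ.laplacian = 0) (k : ℕ) :
    M * Γ.Q k = Γ.sigma k • M := by
  cases k with
  | zero => rw [Q_zero, sigma_zero, mul_one, one_smul]
  | succ k => rw [Q_succ, mul_sub, ← mul_assoc, h, zero_mul, sub_zero, mul_smul_comm, mul_one]

theorem Q_mul_of_laplacian_mul_eq_zero {M : Matrix V V ℝ} (h : Γ.laplacian * M = 0) (k : ℕ) :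
    Γ.Q k * M = Γ.sigma k • M := by
  cases k with
  | zero => rw [Q_zero, sigma_zero, one_mul, one_smul]
  | succ k =>
    rw [Q_succ, (Γ.commute_laplacian_Q k).eq, sub_mul, mul_assoc, h, mul_zero, sub_zero,
      smul_mul_assoc, one_mul]

/-! ### Maximum in-forests and the properties of `J̃`. -/

/-- Deleting an arc from an in-forest leaves an in-forest, so one descends from a maximum one.
Nonemptiness makes `σ_k` positive and hence invertible. -/
theorem inForests_nonempty {k : ℕ} (hk : k ≤ Fintype.card V - Γ.inForestDim) :
    (Γ.inForests k).Nonempty := by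
  induction hk using Nat.decreasingInduction with
  | self =>
    -- The arcless forest shows that the infimum is attained, not the default value `0` of `sInf ∅`.
    have hne : {m | ∃ A, Γ.IsInForest A ∧ numTrees A = m}.Nonempty :=
      ⟨_, ∅, Γ.isInForest_iff.2 ⟨by simp, IsRootedForest.empty⟩, rfl⟩
    obtain ⟨A, hA, h⟩ := Nat.sInf_mem hne
    rw [isInForest_iff] at hA
    refine ⟨A, Γ.mem_inForests.2 ⟨hA.1, mem_rootedForests.2 ⟨hA.2, ?_⟩⟩⟩
    have := hA.2.numTrees_add_card
    rw [inForestDim]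
    omega
  | @of_succ k _ ih =>
    obtain ⟨A, hA⟩ := ih
    obtain ⟨hpos, hA⟩ := Γ.mem_inForests.1 hA
    obtain ⟨hA, hc⟩ := mem_rootedForests.1 hA
    obtain ⟨a, ha⟩ : A.Nonempty := Finset.card_pos.1 (by omega)
    refine ⟨A.erase a, Γ.mem_inForests.2 ⟨fun b hb => hpos b (Finset.mem_of_mem_erase hb),
      mem_rootedForests.2 ⟨hA.erase ha, ?_⟩⟩⟩
    rw [Finset.card_erase_of_mem ha, hc]
    rfl

theorem sigma_pos {k : ℕ} (hk : k ≤ Fintype.card V - Γ.inForestDim) : 0 < Γ.sigma k :=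
  Finset.sum_pos (fun _ h => Γ.weight_pos h) (Γ.inForests_nonempty hk)

theorem inForests_eq_empty {k : ℕ} (hk : Fintype.card V - Γ.inForestDim < k) :
    Γ.inForests k = ∅ := by
  rw [Finset.eq_empty_iff_forall_notMem]
  intro A hA
  obtain ⟨hpos, hA⟩ := Γ.mem_inForests.1 hA
  obtain ⟨hA, hc⟩ := mem_rootedForests.1 hA
  have h1 := hA.numTrees_add_card
  have h2 := Γ.inForestDim_le (Γ.isInForest_iff.2 ⟨hpos, hA⟩)
  omega

theorem laplacian_mul_Q_max : Γ.laplacian * Γ.Q (Fintype.card V - Γ.inForestDim) = 0 := by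
  have h := Γ.inForests_eq_empty (Nat.lt_succ_self (Fintype.card V - Γ.inForestDim))
  rw [laplacian_mul_Q, sigma, h, Finset.sum_empty, zero_smul, zero_sub, neg_eq_zero]
  ext i j
  simp [Q, inForestsTo, h]

theorem Q_max_mul_laplacian : Γ.Q (Fintype.card V - Γ.inForestDim) * Γ.laplacian = 0 := by
  rw [← (Γ.commute_laplacian_Q _).eq, laplacian_mul_Q_max]

theorem laplacian_mul_Jtilde : Γ.laplacian * Γ.Jtilde = 0 := by
  rw [Jtilde, J, mul_smul_comm, laplacian_mul_Q_max, smul_zero]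

theorem Jtilde_mul_laplacian : Γ.Jtilde * Γ.laplacian = 0 := by
  rw [Jtilde, J, smul_mul_assoc, Q_max_mul_laplacian, smul_zero]

theorem Jtilde_mul_J {k : ℕ} (hk : k ≤ Fintype.card V - Γ.inForestDim) :
    Γ.Jtilde * Γ.J k = Γ.Jtilde := by
  rw [J, mul_smul_comm, Γ.mul_Q_of_mul_laplacian_eq_zero Γ.Jtilde_mul_laplacian,
    inv_smul_smul₀ (Γ.sigma_pos hk).ne']

theorem J_mul_Jtilde {k : ℕ} (hk : k ≤ Fintype.card V - Γ.inForestDim) :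
    Γ.J k * Γ.Jtilde = Γ.Jtilde := by
  rw [J, smul_mul_assoc, Γ.Q_mul_of_laplacian_mul_eq_zero Γ.laplacian_mul_Jtilde,
    inv_smul_smul₀ (Γ.sigma_pos hk).ne']

theorem isIdempotentElem_Jtilde : IsIdempotentElem Γ.Jtilde :=
  Γ.Jtilde_mul_J le_rfl

/-- The diagonal counts each forest once for every vertex that is its own root, that is, `n - k`
times. -/
theorem trace_Q {k : ℕ} (hk : k ≤ Fintype.card V) :
    (Γ.Q k).trace = ((Fintype.card V - k : ℕ) : ℝ) * Γ.sigma k := by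
  classical
  simp only [Matrix.trace, Matrix.diag_apply, Q_apply]
  rw [Finset.sum_comm, sigma_eq_sum, Finset.mul_sum]
  refine Finset.sum_congr rfl fun F hF => ?_
  obtain ⟨hF', rfl⟩ := mem_rootedForests.1 hF
  simp only [hF'.treeRoot_eq_self_iff]
  rw [← Finset.mul_sum, Finset.sum_boole, ← hF'.card_sinks_add_card, Nat.add_sub_cancel, mul_comm]

theorem trace_Jtilde : Γ.Jtilde.trace = (Γ.inForestDim : ℝ) := by
  rw [Jtilde, J, Matrix.trace_smul, Γ.trace_Q (Nat.sub_le _ _),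
    Nat.sub_sub_self Γ.inForestDim_le_card, smul_eq_mul, mul_comm, mul_assoc,
    mul_inv_cancel₀ (Γ.sigma_pos le_rfl).ne', mul_one]

theorem rank_Jtilde : Γ.Jtilde.rank = Γ.inForestDim := by
  have h := Matrix.trace_of_isIdempotentElem Γ.isIdempotentElem_Jtilde
  rw [trace_Jtilde] at h
  exact_mod_cast h.symm

end WeightedDigraph

end ForestSums

theorem proposition9 (n : ℕ) (hn : 1 < n) (Γ : WeightedDigraph (Fin n)) :
    -- (i)
    (Γ.laplacian * Γ.Jtilde = 0 ∧ Γ.Jtilde * Γ.laplacian = 0 ∧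
      Γ.laplacian * Γ.Q (n - Γ.inForestDim) = 0 ∧ Γ.Q (n - Γ.inForestDim) * Γ.laplacian = 0) ∧
    -- (ii)
    (∀ k : ℕ, k ≤ n - Γ.inForestDim →
      Γ.Jtilde * Γ.J k = Γ.Jtilde ∧ Γ.J k * Γ.Jtilde = Γ.Jtilde) ∧
    -- (iii)
    Γ.Jtilde ^ 2 = Γ.Jtilde ∧
    -- (iv)
    (Γ.Jtilde.rank = Γ.inForestDim ∧
      eigenvalueMultiplicity 1 Γ.Jtilde = Γ.inForestDim ∧
      Γ.Jtilde.trace = (Γ.inForestDim : ℝ) ∧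
      eigenvalueMultiplicity 0 Γ.Jtilde = n - Γ.inForestDim) := by
  have hc : Fintype.card (Fin n) = n := Fintype.card_fin n
  have hL := Γ.laplacian_mul_Q_max
  have hR := Γ.Q_max_mul_laplacian
  have h0 := eigenvalueMultiplicity_zero_of_isIdempotentElem Γ.isIdempotentElem_Jtilde
  rw [hc] at hL hR h0
  rw [Γ.rank_Jtilde] at h0
  refine ⟨⟨Γ.laplacian_mul_Jtilde, Γ.Jtilde_mul_laplacian, hL, hR⟩,
    fun k hk => ⟨Γ.Jtilde_mul_J (hc.symm ▸ hk), Γ.J_mul_Jtilde (hc.symm ▸ hk)⟩,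
    (pow_two _).trans Γ.isIdempotentElem_Jtilde, Γ.rank_Jtilde, ?_, Γ.trace_Jtilde, h0⟩
  rw [eigenvalueMultiplicity_one_of_isIdempotentElem Γ.isIdempotentElem_Jtilde, Γ.rank_Jtilde]
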